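/- Let $X$ be a compact Hausdorff space and let $G$ be a group acting on $X$ by homeomorphisms. Identify the dual $C(X)^*$ of the Banach space $C(X)$ of continuous real-valued functions on $X$ with the space of (finite) regular signed Borel measures on $X$, with the total variation norm $\|\mu\| = |\mu|(X)$, and for $g \in G$ let $g\mu$ be the push-forward, $(g\mu)(A) = \mu(g^{-1}A)$ for Borel sets $A \subseteq X$. Let $0 < \delta < 1$ and let $\mu \in C(X)^*$ be a signed measure such that $\|g\mu - \mu\| \le \frac{\delta}{10}$ for all $g \in G$. Then there exists a $G$-invariant signed measure $\lambda \in C(X)^*$ (that is, $g\lambda = \lambda$ for all $g \in G$) such that $\|\mu - \lambda\| \le 2\delta$. -/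

import Mathlib

open MeasureTheory

/-- The total variation norm `‖μ‖ = |μ|(X)` of a signed measure. -/
noncomputable def tvNorm {X : Type*} [MeasurableSpace X] (μ : SignedMeasure X) : ℝ :=
  (μ.totalVariation Set.univ).toReal

/-- A (finite) signed Borel measure is regular when its total variation measure `|μ|` is. On a
compact Hausdorff space `X` these are the elements of `C(X)^*`; if `X` is moreover metrizable, every
signed Borel measure is regular. -/
def IsRegularSigned {X : Type*} [TopologicalSpace X] [MeasurableSpace X]
    (μ : SignedMeasure X) : Prop :=
  μ.totalVariation.Regular

/-- The translate `gμ`, i.e. the push-forward `(gμ)(A) = μ(g⁻¹A)` of `μ` under `x ↦ g • x`. -/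
noncomputable def gTranslate {G X : Type*} [SMul G X] [MeasurableSpace X] (g : G)
    (μ : SignedMeasure X) : SignedMeasure X :=
  μ.map (fun x => g • x)

open scoped ENNReal

open Filter Topology

/-! Two minimal-norm arguments in Hilbert space each produce an invariant object, since a closed
convex set stable under isometries has a unique, hence fixed, shortest vector. First, `T = |μ|` is
moved by at most `c = 2δ/10` on each set. Minimise the `L²` norm over convex combinations of the
square roots of the translates of `T`; the square of the minimiser is a finite invariant measure `m`
(`exists_invariant_measure`). Since `√(pq) ≥ min p q`, almost invariance keeps the energy of each
combination on a set `Z` at least `T(Z) - 2c` (`le_energy`). Hence the zero set `Z` of the minimiser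
has `T(Z) ≤ 2c`, and off `Z` the measure `T` is absolutely continuous with respect to `m`. Second,
`μ` off `Z` has a density `f` in `L¹(m)` that is almost invariant. The shortest vector among the
`L²` functions all of whose translates are close to `f` on sets is an invariant `u`
(`exists_invariant_integrable`), and `u m` is the required measure. It is regular because `m` is
dominated by countably many translates of `T` (`regular_of_absolutelyContinuous_sum`). -/

/-- The square root of the density of `σ` with respect to `m`. -/
noncomputable def halfDensity {X : Type*} [MeasurableSpace X] (m σ : Measure X) (x : X) : ℝ :=
  √(σ.rnDeriv m x).toReal

/-! ### Half-densities in `L²`. -/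

section halfDensity

variable {X : Type*} [MeasurableSpace X]

lemma measurable_halfDensity (m σ : Measure X) : Measurable (halfDensity m σ) :=
  (Measure.measurable_rnDeriv σ m).ennreal_toReal.sqrt

lemma halfDensity_sq (m σ : Measure X) (x : X) :
    halfDensity m σ x ^ 2 = (σ.rnDeriv m x).toReal :=
  Real.sq_sqrt ENNReal.toReal_nonneg

lemma memLp_halfDensity (m σ : Measure X) [IsFiniteMeasure σ] :
    MemLp (halfDensity m σ) 2 m := by
  rw [memLp_two_iff_integrable_sq (measurable_halfDensity m σ).aestronglyMeasurable]
  simp_rw [halfDensity_sq]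
  exact Measure.integrable_toReal_rnDeriv

lemma halfDensity_mul (m m₀ σ : Measure X) [IsFiniteMeasure m] [IsFiniteMeasure m₀]
    [IsFiniteMeasure σ] (h : σ ≪ m₀) :
    ∀ᵐ x ∂m, halfDensity m σ x = halfDensity m₀ σ x * halfDensity m m₀ x := by
  filter_upwards [Measure.rnDeriv_mul_rnDeriv (κ := m) h] with x hx
  rw [halfDensity, ← hx, Pi.mul_apply, ENNReal.toReal_mul, Real.sqrt_mul ENNReal.toReal_nonneg]
  rfl

lemma halfDensity_map {Y : Type*} [MeasurableSpace Y] (e : X ≃ᵐ Y) (m σ : Measure X)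
    [IsFiniteMeasure m] [IsFiniteMeasure σ] :
    ∀ᵐ x ∂m, halfDensity (m.map e) (σ.map e) (e x) = halfDensity m σ x := by
  filter_upwards [e.measurableEmbedding.rnDeriv_map σ m] with x hx
  rw [halfDensity, hx, halfDensity]

/-- The overlap of two measures on a set bounds the integral of the product of their half-densities
from below. -/
lemma le_setIntegral_halfDensity_mul (m σ τ : Measure X) [IsFiniteMeasure m] [IsFiniteMeasure σ]
    [IsFiniteMeasure τ] (hσ : σ ≪ m) (hτ : τ ≪ m) {Z : Set X} (hZ : MeasurableSet Z) {b : ℝ}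
    (hb : ∀ A, MeasurableSet A → b ≤ σ.real (Z ∩ A) + τ.real (Z \ A)) :
    b ≤ ∫ x in Z, halfDensity m σ x * halfDensity m τ x ∂m := by
  -- On `A` the smaller density is that of `σ`, off `A` that of `τ`; the geometric mean dominates
  -- the minimum.
  set A : Set X := {x | (σ.rnDeriv m x).toReal ≤ (τ.rnDeriv m x).toReal} with hA
  have hAm : MeasurableSet A := measurableSet_le (Measure.measurable_rnDeriv σ m).ennreal_toReal
    (Measure.measurable_rnDeriv τ m).ennreal_toReal
  have hint : Integrable (fun x => halfDensity m σ x * halfDensity m τ x) m :=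
    (memLp_halfDensity m σ).integrable_mul (memLp_halfDensity m τ)
  refine (hb A hAm).trans ?_
  rw [← integral_inter_add_sdiff hAm hint.integrableOn,
    ← Measure.setIntegral_toReal_rnDeriv hσ, ← Measure.setIntegral_toReal_rnDeriv hτ]
  refine add_le_add (setIntegral_mono_on Measure.integrable_toReal_rnDeriv.integrableOn
    hint.integrableOn (hZ.inter hAm) fun x hx => ?_)
    (setIntegral_mono_on Measure.integrable_toReal_rnDeriv.integrableOn
    hint.integrableOn (hZ.diff hAm) fun x hx => ?_)
  · rw [← halfDensity_sq, sq]
    exact mul_le_mul_of_nonneg_left (Real.sqrt_le_sqrt hx.2) (Real.sqrt_nonneg _)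
  · rw [← halfDensity_sq, sq]
    exact mul_le_mul_of_nonneg_right (Real.sqrt_le_sqrt (not_le.1 hx.2).le) (Real.sqrt_nonneg _)

/-- Young's inequality applied to `(u - v)(u + v)`. With `η` small but fixed, `L²` convergence gives
convergence of the energies on every set. -/
lemma abs_setIntegral_sq_sub_le {m : Measure X} {u v : X → ℝ} (hu : MemLp u 2 m)
    (hv : MemLp v 2 m) (A : Set X) {η : ℝ} (hη : 0 < η) :
    |∫ x in A, u x ^ 2 ∂m - ∫ x in A, v x ^ 2 ∂m| ≤
      η⁻¹ * ∫ x, (u x - v x) ^ 2 ∂m + η * (∫ x, u x ^ 2 ∂m + ∫ x, v x ^ 2 ∂m) := by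
  have hu2 := hu.integrable_sq
  have hv2 := hv.integrable_sq
  have huv : Integrable (fun x => (u x - v x) ^ 2) m := (hu.sub hv).integrable_sq
  have huv2 : Integrable (fun x => u x ^ 2 + v x ^ 2) m := hu2.add hv2
  rw [← integral_sub hu2.integrableOn hv2.integrableOn, ← integral_add hu2 hv2,
    ← integral_const_mul, ← integral_const_mul, ← integral_add (huv.const_mul _)
    (huv2.const_mul _)]
  refine abs_integral_le_integral_abs.trans ?_
  refine (setIntegral_le_integral (hu2.sub hv2).abs (ae_of_all _ fun x => abs_nonneg _)).trans ?_
  refine integral_mono (hu2.sub hv2).abs ((huv.const_mul _).add (huv2.const_mul _))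
    fun x => ?_
  obtain ⟨k, hk⟩ : ∃ k, u x - v x = η * k := ⟨η⁻¹ * (u x - v x), by field_simp⟩
  have hsq : u x ^ 2 - v x ^ 2 = η * (k * (u x + v x)) := by linear_combination (u x + v x) * hk
  have hk2 : η⁻¹ * (u x - v x) ^ 2 = η * k ^ 2 := by
    rw [hk]
    field_simp
  simp only [Pi.sub_apply]
  rw [hk2, hsq, ← mul_add, abs_mul, abs_of_pos hη]
  refine mul_le_mul_of_nonneg_left (abs_le.2 ⟨?_, ?_⟩) hη.le
  · nlinarith [sq_nonneg (u x + k / 2), sq_nonneg (v x + k / 2), sq_nonneg k]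
  · nlinarith [sq_nonneg (u x - k / 2), sq_nonneg (v x - k / 2), sq_nonneg k]

end halfDensity

/-! ### Convex combinations of half-densities of translates. -/

section translates

variable {X G : Type*} [MeasurableSpace X] [Group G] [MulAction G X]

/-- The superposition `∑ s, w s * √(d(sT)/dm)` of the half-densities of the translates of `T`. -/
noncomputable def superposition (T : Measure X) (w : G →₀ ℝ) (m : Measure X) (x : X) : ℝ :=
  w.sum fun s c => c * halfDensity m (T.map (s • ·)) x

/-- A finite measure dominating the translates of `T` by the support of `w`. -/
noncomputable def supportMeasure (T : Measure X) (w : G →₀ ℝ) : Measure X :=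
  ∑ s ∈ w.support, T.map (s • ·)

/-- The squared norm on `A` of the superposition of half-densities with weights `w`. -/
noncomputable def energy (T : Measure X) (w : G →₀ ℝ) (A : Set X) : ℝ :=
  ∫ x in A, superposition T w (supportMeasure T w) x ^ 2 ∂(supportMeasure T w)

/-- The finitely supported probability weights on `G`. -/
def probWeights (G : Type*) : Set (G →₀ ℝ) :=
  {w | (∀ s, 0 ≤ w s) ∧ w.sum (fun _ c => c) = 1}

instance (T : Measure X) [IsFiniteMeasure T] (w : G →₀ ℝ) :
    IsFiniteMeasure (supportMeasure T w) := by
  unfold supportMeasure; infer_instance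

lemma map_smul_absolutelyContinuous_supportMeasure (T : Measure X) {w : G →₀ ℝ} {s : G}
    (hs : s ∈ w.support) : T.map (s • ·) ≪ supportMeasure T w := by
  refine Measure.absolutelyContinuous_of_le ?_
  exact Finset.single_le_sum (f := fun s : G => T.map (s • ·)) (fun _ _ => Measure.zero_le _) hs

lemma supportMeasure_absolutelyContinuous {T : Measure X} {w : G →₀ ℝ} {m : Measure X}
    (h : ∀ s ∈ w.support, T.map (s • ·) ≪ m) : supportMeasure T w ≪ m := by
  intro A hA
  rw [supportMeasure, Measure.finsetSum_apply]
  exact Finset.sum_eq_zero fun s hs => h s hs hA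

lemma superposition_add (T : Measure X) (w w' : G →₀ ℝ) (m : Measure X) (x : X) :
    superposition T (w + w') m x = superposition T w m x + superposition T w' m x :=
  Finsupp.sum_add_index' (by simp) (by intros; ring)

lemma superposition_smul (T : Measure X) (a : ℝ) (w : G →₀ ℝ) (m : Measure X) (x : X) :
    superposition T (a • w) m x = a * superposition T w m x := by
  rw [superposition, Finsupp.sum_smul_index' (by simp), superposition, Finsupp.mul_sum]
  simp [mul_assoc]

variable (T : Measure X)

lemma memLp_superposition [IsFiniteMeasure T] (w : G →₀ ℝ) (m : Measure X) :
    MemLp (superposition T w m) 2 m := by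
  have : superposition T w m = fun x => ∑ s ∈ w.support, w s * halfDensity m (T.map (s • ·)) x :=
    rfl
  rw [this]
  exact memLp_finsetSum _ fun s _ => (memLp_halfDensity m _).const_mul _

/-- By the chain rule, changing the dominating measure multiplies all half-densities by one common
factor, whose square is absorbed by the change of measure. Energies are thus intrinsic, and any two
combinations can be compared over a common `m`. -/
lemma energy_eq [IsFiniteMeasure T] (w : G →₀ ℝ) (m : Measure X) [IsFiniteMeasure m]
    (h : ∀ s ∈ w.support, T.map (s • ·) ≪ m) (A : Set X) :
    energy T w A = ∫ x in A, superposition T w m x ^ 2 ∂m := by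
  have hac := supportMeasure_absolutelyContinuous h
  rw [energy, ← setIntegral_toReal_rnDeriv_mul' hac]
  have h1 : ∀ᵐ x ∂m, ∀ s ∈ w.support, halfDensity m (T.map (s • ·)) x =
      halfDensity (supportMeasure T w) (T.map (s • ·)) x * halfDensity m (supportMeasure T w) x :=
    (Finset.eventually_all _).2 fun s hs =>
      halfDensity_mul m _ _ (map_smul_absolutelyContinuous_supportMeasure T hs)
  refine integral_congr_ae (ae_restrict_of_ae ?_)
  filter_upwards [h1] with x hx
  have : superposition T w m x =
      superposition T w (supportMeasure T w) x * halfDensity m (supportMeasure T w) x := by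
    rw [superposition, superposition, Finsupp.sum_mul]
    exact Finset.sum_congr rfl fun s hs => by
      dsimp only
      rw [hx s hs, mul_assoc]
  rw [this, mul_pow, halfDensity_sq, mul_comm]

lemma map_mul_smul [MeasurableConstSMul G X] (g s : G) : T.map ((g * s) • ·) = (T.map (s • ·)).map (g • ·) := by
  rw [Measure.map_map (measurable_const_smul g) (measurable_const_smul s)]
  congr 1
  ext x
  exact mul_smul g s x

lemma energy_mapDomain [MeasurableConstSMul G X] [IsFiniteMeasure T] (w : G →₀ ℝ) (g : G) {A : Set X} (hA : MeasurableSet A) :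
    energy T (w.mapDomain (g * ·)) A = energy T w ((g • ·) ⁻¹' A) := by
  classical
  have hac : ∀ s ∈ (w.mapDomain (g * ·)).support,
      T.map (s • ·) ≪ (supportMeasure T w).map (g • ·) := by
    intro s hs
    obtain ⟨t, ht, rfl⟩ := Finset.mem_image.1 (Finsupp.mapDomain_support hs)
    rw [map_mul_smul]
    exact (map_smul_absolutelyContinuous_supportMeasure T ht).map (measurable_const_smul g)
  have hmeas : AEStronglyMeasurable (fun x => superposition T (w.mapDomain (g * ·))
      ((supportMeasure T w).map (g • ·)) x ^ 2) ((supportMeasure T w).map (g • ·)) :=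
    (memLp_superposition T _ _).aestronglyMeasurable.pow 2
  rw [energy_eq T _ _ hac, energy,
    setIntegral_map hA hmeas (measurable_const_smul g).aemeasurable]
  have h1 : ∀ᵐ x ∂(supportMeasure T w), ∀ s ∈ w.support,
      halfDensity ((supportMeasure T w).map (g • ·)) ((T.map (s • ·)).map (g • ·)) (g • x) =
        halfDensity (supportMeasure T w) (T.map (s • ·)) x :=
    (Finset.eventually_all _).2 fun s hs =>
      halfDensity_map (MeasurableEquiv.smul g) (supportMeasure T w) (T.map (s • ·))
  refine integral_congr_ae (ae_restrict_of_ae ?_)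
  filter_upwards [h1] with x hx
  have : superposition T (w.mapDomain (g * ·)) ((supportMeasure T w).map (g • ·)) (g • x) =
      superposition T w (supportMeasure T w) x := by
    rw [superposition, Finsupp.sum_mapDomain_index (by simp) (by intros; ring), superposition]
    exact Finset.sum_congr rfl fun s hs => by
      dsimp only
      rw [map_mul_smul, hx s hs]
  rw [this]

lemma mapDomain_mem_probWeights {w : G →₀ ℝ} (hw : w ∈ probWeights G) (g : G) :
    w.mapDomain (g * ·) ∈ probWeights G := by
  refine ⟨fun s => ?_, ?_⟩
  · have := Finsupp.mapDomain_apply (mul_right_injective g) w (g⁻¹ * s)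
    rw [mul_inv_cancel_left] at this
    exact this ▸ hw.1 _
  · rw [Finsupp.sum_mapDomain_index (by simp) (by simp)]
    exact hw.2

lemma midpoint_mem_probWeights {G : Type*} {w w' : G →₀ ℝ} (hw : w ∈ probWeights G)
    (hw' : w' ∈ probWeights G) : (1 / 2 : ℝ) • (w + w') ∈ probWeights G := by
  refine ⟨fun s => ?_, ?_⟩
  · have := hw.1 s
    have := hw'.1 s
    simp only [Finsupp.smul_apply, Finsupp.add_apply, smul_eq_mul]
    positivity
  · rw [Finsupp.sum_smul_index' (by simp)]
    simp only [smul_eq_mul]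
    rw [← Finsupp.mul_sum, Finsupp.sum_add_index' (by simp) (by simp), hw.2, hw'.2]
    norm_num

lemma single_mem_probWeights : Finsupp.single (1 : G) (1 : ℝ) ∈ probWeights G := by
  classical
  refine ⟨fun s => ?_, by simp⟩
  rw [Finsupp.single_apply]
  split_ifs <;> norm_num

lemma energy_nonneg (w : G →₀ ℝ) (A : Set X) : 0 ≤ energy T w A :=
  integral_nonneg fun _ => sq_nonneg _

/-- The parallelogram law for superpositions of half-densities. -/
lemma integral_superposition_sub_sq_le [IsFiniteMeasure T] {d : ℝ} (hd : ∀ w ∈ probWeights G, d ≤ energy T w Set.univ)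
    {w w' : G →₀ ℝ} (hw : w ∈ probWeights G) (hw' : w' ∈ probWeights G) (m : Measure X)
    [IsFiniteMeasure m] (h : ∀ s ∈ w.support, T.map (s • ·) ≪ m)
    (h' : ∀ s ∈ w'.support, T.map (s • ·) ≪ m) :
    ∫ x, (superposition T w m x - superposition T w' m x) ^ 2 ∂m ≤
      2 * energy T w Set.univ + 2 * energy T w' Set.univ - 4 * d := by
  classical
  have hmid := hd _ (midpoint_mem_probWeights hw hw')
  have hac : ∀ s ∈ ((1 / 2 : ℝ) • (w + w')).support, T.map (s • ·) ≪ m := fun s hs => by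
    rcases Finset.mem_union.1 (Finsupp.support_add (Finsupp.support_smul hs)) with hs | hs
    exacts [h s hs, h' s hs]
  rw [energy_eq T _ m hac, setIntegral_univ] at hmid
  rw [energy_eq T _ m h, energy_eq T _ m h', setIntegral_univ, setIntegral_univ]
  simp only [superposition_smul, superposition_add] at hmid
  have hu := memLp_superposition T w m
  have hv := memLp_superposition T w' m
  have i1 : Integrable (fun x => (superposition T w m x - superposition T w' m x) ^ 2) m :=
    (hu.sub hv).integrable_sq
  have i2 : Integrable
      (fun x => (1 / 2 * (superposition T w m x + superposition T w' m x)) ^ 2) m :=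
    ((hu.add hv).const_mul _).integrable_sq
  have key : ∫ x, (superposition T w m x - superposition T w' m x) ^ 2 ∂m +
      4 * ∫ x, (1 / 2 * (superposition T w m x + superposition T w' m x)) ^ 2 ∂m =
      2 * ∫ x, superposition T w m x ^ 2 ∂m + 2 * ∫ x, superposition T w' m x ^ 2 ∂m := by
    simp only [← integral_const_mul]
    rw [← integral_add i1 (i2.const_mul _), ← integral_add (hu.integrable_sq.const_mul _)
      (hv.integrable_sq.const_mul _)]
    congr 1
    ext x
    ring
  linarith

/-- The energy on a set of probability weights is bounded below if `T` is almost invariant. -/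
lemma le_energy [MeasurableConstSMul G X] [IsFiniteMeasure T] {c : ℝ} (hc : ∀ (g : G) (A : Set X), MeasurableSet A →
    T.real A ≤ T.real ((g • ·) ⁻¹' A) + c) {w : G →₀ ℝ} (hw : w ∈ probWeights G) {Z : Set X}
    (hZ : MeasurableSet Z) : T.real Z - 2 * c ≤ energy T w Z := by
  set m := supportMeasure T w with hm
  have hac : ∀ s ∈ w.support, T.map (s • ·) ≪ m := fun s hs =>
    map_smul_absolutelyContinuous_supportMeasure T hs
  have hov : ∀ s ∈ w.support, ∀ t ∈ w.support, T.real Z - 2 * c ≤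
      ∫ x in Z, halfDensity m (T.map (s • ·)) x * halfDensity m (T.map (t • ·)) x ∂m := by
    intro s hs t ht
    -- Pulling back `Z ∩ A` by `s` and `Z \ A` by `t` costs `c` each, whence `2 * c`.
    refine le_setIntegral_halfDensity_mul m _ _ (hac s hs) (hac t ht) hZ fun A hA => ?_
    rw [map_measureReal_apply (measurable_const_smul s) (hZ.inter hA),
      map_measureReal_apply (measurable_const_smul t) (hZ.diff hA)]
    have h1 := hc s _ (hZ.inter hA)
    have h2 := hc t _ (hZ.diff hA)
    have h3 := measureReal_inter_add_sdiff (μ := T) (s := Z) hA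
    linarith
  have hint : ∀ s t : G, IntegrableOn (fun x => halfDensity m (T.map (s • ·)) x *
      halfDensity m (T.map (t • ·)) x) Z m := fun s t =>
    ((memLp_halfDensity m _).integrable_mul (memLp_halfDensity m _)).integrableOn
  have hexp : energy T w Z = ∑ s ∈ w.support, ∑ t ∈ w.support, w s * w t *
      ∫ x in Z, halfDensity m (T.map (s • ·)) x * halfDensity m (T.map (t • ·)) x ∂m := by
    have : ∀ x, superposition T w m x ^ 2 = ∑ s ∈ w.support, ∑ t ∈ w.support,
        w s * w t * (halfDensity m (T.map (s • ·)) x * halfDensity m (T.map (t • ·)) x) := by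
      intro x
      rw [sq, superposition, Finsupp.sum, Finset.sum_mul_sum]
      exact Finset.sum_congr rfl fun s _ => Finset.sum_congr rfl fun t _ => by ring
    rw [energy]
    simp only [← hm, this]
    rw [integral_finsetSum _ fun s _ => integrable_finsetSum _ fun t _ => (hint s t).const_mul _]
    refine Finset.sum_congr rfl fun s _ => ?_
    rw [integral_finsetSum _ fun t _ => (hint s t).const_mul _]
    exact Finset.sum_congr rfl fun t _ => integral_const_mul _ _
  have hone : ∑ s ∈ w.support, w s = 1 := hw.2
  calc T.real Z - 2 * c
      = ∑ s ∈ w.support, ∑ t ∈ w.support, w s * w t * (T.real Z - 2 * c) := by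
        simp only [← Finset.sum_mul, ← Finset.mul_sum, hone, mul_one, one_mul]
    _ ≤ _ := by
        rw [hexp]
        exact Finset.sum_le_sum fun s hs => Finset.sum_le_sum fun t ht =>
          mul_le_mul_of_nonneg_left (hov s hs t ht) (mul_nonneg (hw.1 s) (hw.1 t))

end translates

/-! ### The invariant measure from the energy minimiser. -/

lemma tendsto_zero_of_abs_le_inv_mul_add {x a : ℕ → ℝ} {B : ℝ} (ha : Tendsto a atTop (𝓝 0))
    (h : ∀ η > 0, ∀ n, |x n| ≤ η⁻¹ * a n + η * B) : Tendsto x atTop (𝓝 0) := by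
  rw [Metric.tendsto_atTop]
  intro ε hε
  have hB : 0 < 2 * (|B| + 1) := by positivity
  set η := ε / (2 * (|B| + 1)) with hη
  have hη0 : 0 < η := div_pos hε hB
  obtain ⟨N, hN⟩ := eventually_atTop.1 (ha.eventually_lt_const (mul_pos hη0 (half_pos hε)))
  refine ⟨N, fun n hn => ?_⟩
  rw [Real.dist_eq, sub_zero]
  have h1 : η⁻¹ * a n < ε / 2 := by
    rw [inv_mul_lt_iff₀ hη0]
    exact hN n hn
  have h2 : η * B ≤ ε / 2 := by
    calc η * B ≤ η * (|B| + 1) := by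
          gcongr
          linarith [le_abs_self B]
      _ = ε / 2 := by rw [hη]; field_simp
  linarith [h η hη0 n]

lemma norm_toLp_two_sq {X : Type*} [MeasurableSpace X] {m : Measure X} {f : X → ℝ}
    (hf : MemLp f 2 m) : ‖hf.toLp f‖ ^ 2 = ∫ x, f x ^ 2 ∂m := by
  rw [← real_inner_self_eq_norm_sq, L2.inner_def]
  refine integral_congr_ae ?_
  filter_upwards [hf.coeFn_toLp] with x hx
  rw [real_inner_self_eq_norm_sq, hx, Real.norm_eq_abs, sq_abs]

/-- If the translates of a finite measure `T` are uniformly close to `T`, then some finite invariant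
measure dominates `T` outside a set of small measure. -/
theorem exists_invariant_measure {X G : Type*} [MeasurableSpace X] [Group G] [MulAction G X]
    [MeasurableConstSMul G X] (T : Measure X) [IsFiniteMeasure T] {c : ℝ}
    (hc : ∀ (g : G) (A : Set X), MeasurableSet A → T.real A ≤ T.real ((g • ·) ⁻¹' A) + c) :
    ∃ (m : Measure X) (s : ℕ → G) (Z : Set X), IsFiniteMeasure m ∧
      (∀ g : G, m.map (g • ·) = m) ∧ m ≪ Measure.sum (fun n => T.map (s n • ·)) ∧
      MeasurableSet Z ∧ m Z = 0 ∧ T.restrict Zᶜ ≪ m ∧ T.real Z ≤ 2 * c := by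
  classical
  set d := sInf ((fun w : G →₀ ℝ => energy T w Set.univ) '' probWeights G) with hd_def
  have hbdd : BddBelow ((fun w : G →₀ ℝ => energy T w Set.univ) '' probWeights G) :=
    ⟨0, by rintro _ ⟨w, -, rfl⟩; exact energy_nonneg T w _⟩
  have hd : ∀ w ∈ probWeights G, d ≤ energy T w Set.univ := fun w hw =>
    csInf_le hbdd ⟨w, hw, rfl⟩
  have hex : ∀ n : ℕ, ∃ w ∈ probWeights G, energy T w Set.univ < d + (1 / 4) ^ n := by
    intro n
    obtain ⟨_, ⟨w, hw, rfl⟩, hlt⟩ := exists_lt_of_csInf_lt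
      (Set.Nonempty.image _ ⟨_, single_mem_probWeights⟩)
      (show d < d + (1 / 4) ^ n from lt_add_of_pos_right _ (by positivity))
    exact ⟨w, hw, hlt⟩
  choose w hw hlt using hex
  have hE : Tendsto (fun n => energy T (w n) Set.univ - d) atTop (𝓝 0) := by
    refine squeeze_zero (fun n => sub_nonneg.2 (hd _ (hw n)))
      (fun n => (sub_lt_iff_lt_add'.2 (hlt n)).le) ?_
    exact tendsto_pow_atTop_nhds_zero_of_lt_one (by norm_num) (by norm_num)
  have hE1 : ∀ n, energy T (w n) Set.univ ≤ d + 1 := fun n =>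
    (hlt n).le.trans (by gcongr; exact pow_le_one₀ (by norm_num) (by norm_num))
  -- Only countably many translates occur in the minimising sequence, even if `G` is uncountable.
  -- Adding `1` ensures that `T` itself is dominated.
  obtain ⟨s, hs⟩ : ∃ s : ℕ → G, insert 1 (⋃ n, ((w n).support : Set G)) = Set.range s :=
    Set.Countable.exists_eq_range
      ((Set.countable_iUnion fun n => (w n).support.countable_toSet).insert 1)
      (Set.insert_nonempty _ _)
  set m₀ : Measure X := (Measure.sum fun n => T.map (s n • ·)).toFinite with hm₀
  have hac : ∀ t ∈ Set.range s, T.map (t • ·) ≪ m₀ := by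
    rintro _ ⟨n, rfl⟩ A hA
    rw [hm₀, toFinite_apply_eq_zero_iff] at hA
    exact Measure.absolutelyContinuous_of_le (Measure.le_sum (fun n => T.map (s n • ·)) n) hA
  have hacw : ∀ n, ∀ t ∈ (w n).support, T.map (t • ·) ≪ m₀ := fun n t ht =>
    hac t (hs ▸ Set.mem_insert_of_mem _ (Set.mem_iUnion.2 ⟨n, ht⟩))
  have hT : T ≪ m₀ := by
    simpa using hac 1 (hs ▸ Set.mem_insert _ _)
  have hv := fun n => memLp_superposition T (w n) m₀
  set v : ℕ → Lp ℝ 2 m₀ := fun n => (hv n).toLp with hv_def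
  have hcauchy : CauchySeq v := by
    -- The parallelogram law bounds the squared distance by `2(1/4)^n + 2(1/4)^(n+1)`, which is
    -- below `(2/2^n)^2 = 4(1/4)^n`.
    refine cauchySeq_of_le_geometric_two (C := 4) fun n => ?_
    rw [dist_eq_norm]
    refine le_of_sq_le_sq ?_ (by positivity)
    rw [hv_def, ← MemLp.toLp_sub, norm_toLp_two_sq]
    refine (integral_superposition_sub_sq_le T hd (hw n) (hw (n + 1)) m₀ (hacw n)
      (hacw (n + 1))).trans ?_
    have h1 := hlt n
    have h2 := hlt (n + 1)
    have h3 : (4 / 2 / 2 ^ n : ℝ) ^ 2 = 4 * (1 / 4) ^ n := by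
      rw [div_pow, ← pow_mul, mul_comm n 2, pow_mul, one_div, inv_pow]
      norm_num
      rfl
    rw [pow_succ] at h2
    have h4 : (0 : ℝ) < (1 / 4) ^ n := by positivity
    rw [h3]
    linarith
  obtain ⟨ψ, hψ⟩ := cauchySeq_tendsto_of_complete hcauchy
  have hψL : MemLp ψ 2 m₀ := Lp.memLp ψ
  have hψm : Measurable ψ := (Lp.stronglyMeasurable ψ).measurable
  have hlim : ∀ A, Tendsto (fun n => energy T (w n) A) atTop (𝓝 (∫ x in A, ψ x ^ 2 ∂m₀)) := by
    intro A
    rw [← tendsto_sub_nhds_zero_iff]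
    refine tendsto_zero_of_abs_le_inv_mul_add (a := fun n => ‖v n - ψ‖ ^ 2)
      (B := d + 1 + ∫ x, ψ x ^ 2 ∂m₀) ?_ fun η hη n => ?_
    · simpa using ((tendsto_iff_norm_sub_tendsto_zero.1 hψ).pow 2)
    · rw [energy_eq T (w n) m₀ (hacw n)]
      refine (abs_setIntegral_sq_sub_le (hv n) hψL A hη).trans ?_
      have h1 : ‖v n - ψ‖ ^ 2 = ∫ x, (superposition T (w n) m₀ x - ψ x) ^ 2 ∂m₀ := by
        have : v n - ψ = ((hv n).sub hψL).toLp := by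
          rw [MemLp.toLp_sub (hv n) hψL, Lp.toLp_coeFn]
        rw [this, norm_toLp_two_sq]
        rfl
      have h2 := hE1 n
      rw [energy_eq T (w n) m₀ (hacw n), setIntegral_univ] at h2
      rw [h1]
      gcongr
  -- Translating by `g` gives another minimising sequence, which the parallelogram law forces to be
  -- asymptotic to the first. The translates by `g` need not be dominated by `m₀`, so each
  -- comparison uses its own dominating measure.
  have hinv : ∀ (g : G) (A : Set X), MeasurableSet A →
      ∫ x in (g • ·) ⁻¹' A, ψ x ^ 2 ∂m₀ = ∫ x in A, ψ x ^ 2 ∂m₀ := by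
    intro g A hA
    have h0 : Tendsto (fun n => energy T ((w n).mapDomain (g * ·)) A - energy T (w n) A) atTop
        (𝓝 0) := by
      refine tendsto_zero_of_abs_le_inv_mul_add (B := 2 * (d + 1))
        (a := fun n => 4 * (energy T (w n) Set.univ - d)) (by simpa using hE.const_mul 4)
        fun η hη n => ?_
      set w' := (w n).mapDomain (g * ·) with hw'
      set m := supportMeasure T (w n) + supportMeasure T w'
      have h1 : ∀ t ∈ (w n).support, T.map (t • ·) ≪ m := fun t ht =>
        (map_smul_absolutelyContinuous_supportMeasure T ht).trans
          (Measure.AbsolutelyContinuous.rfl.add_right _)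
      have h2 : ∀ t ∈ w'.support, T.map (t • ·) ≪ m := fun t ht =>
        (map_smul_absolutelyContinuous_supportMeasure T ht).trans
          (Measure.AbsolutelyContinuous.rfl.add_right' _)
      have hEw' : energy T w' Set.univ = energy T (w n) Set.univ := by
        rw [hw', energy_mapDomain T _ _ MeasurableSet.univ, Set.preimage_univ]
      have h3 := integral_superposition_sub_sq_le T hd (mapDomain_mem_probWeights (hw n) g) (hw n)
        m h2 h1
      have h4 := abs_setIntegral_sq_sub_le (memLp_superposition T w' m)
        (memLp_superposition T (w n) m) A hη
      have h5 := hE1 n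
      rw [← energy_eq T _ m h1, ← energy_eq T _ m h2, ← setIntegral_univ (μ := m)
        (f := fun x => superposition T w' m x ^ 2), ← setIntegral_univ (μ := m)
        (f := fun x => superposition T (w n) m x ^ 2), ← energy_eq T _ m h1, ← energy_eq T _ m h2,
        hEw'] at h4
      refine h4.trans (add_le_add (mul_le_mul_of_nonneg_left ?_ (inv_pos.2 hη).le)
        (mul_le_mul_of_nonneg_left (by linarith) hη.le))
      rw [← hw', hEw'] at h3
      linarith
    simp only [energy_mapDomain T _ g hA] at h0
    exact sub_eq_zero.1 (tendsto_nhds_unique ((hlim _).sub (hlim _)) h0)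
  have hsqm : Measurable fun x => ENNReal.ofReal (ψ x ^ 2) := (hψm.pow_const 2).ennreal_ofReal
  have hZ : MeasurableSet {x | ψ x = 0} := hψm (measurableSet_singleton 0)
  refine ⟨m₀.withDensity fun x => ENNReal.ofReal (ψ x ^ 2), s, {x | ψ x = 0},
    isFiniteMeasure_withDensity_ofReal hψL.integrable_sq.2, fun g => ?_, ?_, hZ, ?_, ?_, ?_⟩
  · ext A hA
    rw [Measure.map_apply (measurable_const_smul g) hA, withDensity_apply _ hA,
      withDensity_apply _ (measurable_const_smul g hA),
      ← ofReal_integral_eq_lintegral_ofReal hψL.integrable_sq.integrableOn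
        (ae_of_all _ fun x => sq_nonneg _),
      ← ofReal_integral_eq_lintegral_ofReal hψL.integrable_sq.integrableOn
        (ae_of_all _ fun x => sq_nonneg _), hinv g A hA]
  · refine (withDensity_absolutelyContinuous _ _).trans fun A hA => ?_
    rwa [hm₀, toFinite_apply_eq_zero_iff]
  · rw [withDensity_apply _ hZ]
    exact (setLIntegral_congr_fun hZ fun x (hx : ψ x = 0) => by simp [hx]).trans lintegral_zero
  · refine Measure.AbsolutelyContinuous.mk fun A hA h0 => ?_
    rw [withDensity_apply_eq_zero hsqm] at h0
    rw [Measure.restrict_apply hA]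
    refine hT (measure_mono_null ?_ h0)
    rintro x ⟨hxA, hx⟩
    refine ⟨?_, hxA⟩
    have : ψ x ≠ 0 := hx
    simpa using this
  -- The energies on the zero set tend to `0` but are all at least `T(Z) - 2c`.
  · have h0 : ∫ x in {x | ψ x = 0}, ψ x ^ 2 ∂m₀ = 0 :=
      setIntegral_eq_zero_of_forall_eq_zero fun x (hx : ψ x = 0) => by rw [hx]; norm_num
    have := ge_of_tendsto' (hlim {x | ψ x = 0}) fun n => le_energy T hc (hw n) hZ
    linarith

/-! ### Regularity under countable domination. -/

/-- A finite measure dominated by countably many finite regular measures is regular. -/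
theorem regular_of_absolutelyContinuous_sum {X : Type*} [TopologicalSpace X] [T2Space X]
    [MeasurableSpace X] [BorelSpace X] (ν : Measure X) [IsFiniteMeasure ν] (τ : ℕ → Measure X)
    [∀ n, IsFiniteMeasure (τ n)] [∀ n, (τ n).Regular] (h : ν ≪ Measure.sum τ) : ν.Regular := by
  have : ν.InnerRegularCompactLTTop := by
    refine ⟨?_⟩
    rintro A ⟨hA, -⟩ r hr
    -- The compact sets `K (n, k)` exhaust `A` up to a `τ n`-null set for every `n`, hence up to a
    -- `ν`-null set; finitely many of them then suffice.
    have hK : ∀ p : ℕ × ℕ, ∃ K ⊆ A, IsCompact K ∧ τ p.1 (A \ K) < ((p.2 : ℝ≥0∞) + 1)⁻¹ :=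
      fun p => hA.exists_isCompact_sdiff_lt (measure_ne_top _ _) (by simp)
    choose K hKA hKc hKlt using hK
    set K' : ℕ → Set X := fun j => K j.unpair with hK'
    have hnull : ν (A \ ⋃ j, K' j) = 0 := by
      refine h ?_
      rw [Measure.sum_apply _ (hA.diff (.iUnion fun j => (hKc _).measurableSet)),
        ENNReal.tsum_eq_zero]
      intro n
      refine le_antisymm (ge_of_tendsto' (ENNReal.tendsto_inv_nat_nhds_zero.comp
        (tendsto_add_atTop_nat 1)) fun k => ?_) bot_le
      have hsub : K (n, k) ⊆ ⋃ j, K' j := by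
        refine Set.subset_iUnion_of_subset (Nat.pair n k) ?_
        simp [hK']
      simpa using (measure_mono (Set.sdiff_subset_sdiff_right hsub)).trans (hKlt (n, k)).le
    have hAB : ν A = ν (⋃ j, K' j) := by
      refine le_antisymm ?_ (measure_mono (Set.iUnion_subset fun j => hKA _))
      calc ν A ≤ ν ((A \ ⋃ j, K' j) ∪ ⋃ j, K' j) :=
            measure_mono (by rw [Set.sdiff_union_self]; exact Set.subset_union_left)
        _ ≤ _ := (measure_union_le _ _).trans (by rw [hnull, zero_add])
    rw [hAB] at hr
    obtain ⟨N, hN⟩ := ((tendsto_measure_iUnion_accumulate (μ := ν) (f := K')).eventually_const_lt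
      hr).exists
    refine ⟨Set.accumulate K' N, ?_, ?_, hN⟩
    · exact Set.iUnion₂_subset fun j _ => hKA _
    · exact (Set.finite_Iic N).isCompact_biUnion fun j _ => hKc _
  infer_instance

/-! ### Total variation of signed measures. -/

section signed

variable {X : Type*} [MeasurableSpace X]

lemma exists_totalVariation_real_eq (μ : SignedMeasure X) : ∃ P, MeasurableSet P ∧
    ∀ A, MeasurableSet A → μ.totalVariation.real A = μ (A ∩ P) - μ (A \ P) := by
  obtain ⟨P, hP, h1, h2, hpos, hneg⟩ := μ.toJordanDecomposition_spec
  refine ⟨P, hP, fun A hA => ?_⟩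
  rw [SignedMeasure.totalVariation, measureReal_add_apply, hpos, hneg,
    SignedMeasure.toMeasureOfZeroLE_real_apply _ _ hP hA,
    SignedMeasure.toMeasureOfLEZero_real_apply _ _ hP.compl hA, Set.inter_comm, Set.sdiff_eq,
    Set.inter_comm Pᶜ, sub_eq_add_neg]

lemma abs_apply_le_tvNorm (μ : SignedMeasure X) (A : Set X) : |μ A| ≤ tvNorm μ :=
  (μ.norm_le_totalVariation A).trans (measureReal_mono (Set.subset_univ A))

lemma tvNorm_le_of_forall_abs_apply_le {μ : SignedMeasure X} {b : ℝ}
    (h : ∀ A, MeasurableSet A → |μ A| ≤ b) : tvNorm μ ≤ 2 * b := by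
  obtain ⟨P, hP, hA⟩ := exists_totalVariation_real_eq μ
  have := hA Set.univ MeasurableSet.univ
  rw [Set.univ_inter] at this
  have h1 := abs_le.1 (h P hP)
  have h2 := abs_le.1 (h _ (MeasurableSet.univ.diff hP))
  change μ.totalVariation.real Set.univ ≤ _
  linarith

variable {G : Type*} [Group G] [MulAction G X] [MeasurableConstSMul G X]

/-- A Hahn set splits `A` into a positive and a negative part, and each contributes one error `ε`.
-/
lemma totalVariation_real_le_preimage_add {μ : SignedMeasure X} {ε : ℝ}
    (h : ∀ (g : G) (A : Set X), MeasurableSet A → |μ ((g • ·) ⁻¹' A) - μ A| ≤ ε) (g : G)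
    {A : Set X} (hA : MeasurableSet A) :
    μ.totalVariation.real A ≤ μ.totalVariation.real ((g • ·) ⁻¹' A) + 2 * ε := by
  obtain ⟨P, hP, hPA⟩ := exists_totalVariation_real_eq μ
  have h1 := abs_le.1 (h g _ (hA.inter hP))
  have h2 := abs_le.1 (h g _ (hA.diff hP))
  have h3 := abs_le.1 (μ.norm_le_totalVariation ((g • ·) ⁻¹' (A ∩ P)))
  have h4 := abs_le.1 (μ.norm_le_totalVariation ((g • ·) ⁻¹' (A \ P)))
  have h5 := measureReal_inter_add_sdiff (μ := μ.totalVariation) (s := (g • ·) ⁻¹' A)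
    (measurable_const_smul g hP)
  rw [← Set.preimage_inter, ← Set.preimage_sdiff] at h5
  rw [hPA A hA]
  linarith

end signed

/-! ### The invariant density. -/

/-- An integrable function whose integrals over sets are, up to `b`, invariant under a
measure-preserving action is close to an invariant integrable function. -/
theorem exists_invariant_integrable {X G : Type*} [MeasurableSpace X] [Group G] [MulAction G X]
    [MeasurableConstSMul G X] (m : Measure X) [IsFiniteMeasure m]
    (hm : ∀ g : G, m.map (g • ·) = m) {f : X → ℝ} (hf : Integrable f m) {b η : ℝ} (hη : 0 < η)
    (hb : ∀ (g : G) (A : Set X), MeasurableSet A →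
      |∫ x in (g • ·) ⁻¹' A, f x ∂m - ∫ x in A, f x ∂m| ≤ b) :
    ∃ u : X → ℝ, Integrable u m ∧
      (∀ (g : G) (A : Set X), MeasurableSet A →
        ∫ x in (g • ·) ⁻¹' A, u x ∂m = ∫ x in A, u x ∂m) ∧
      ∀ A, MeasurableSet A → |∫ x in A, u x ∂m - ∫ x in A, f x ∂m| ≤ b + η := by
  have hmp : ∀ g : G, MeasurePreserving (g • · : X → X) m m :=
    fun g => ⟨measurable_const_smul g, hm g⟩
  have hemb : ∀ g : G, MeasurableEmbedding (g • · : X → X) := fun g =>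
    (MeasurableEquiv.smul g).measurableEmbedding
  let ind : G → {A : Set X // MeasurableSet A} → Lp ℝ 2 m := fun g A =>
    indicatorConstLp 2 (measurable_const_smul g A.2) (measure_ne_top m _) (1 : ℝ)
  -- Quantifying over all `g` makes `C` stable under the action.
  let C : Set (Lp ℝ 2 m) := ⋂ g : G, ⋂ A : {A : Set X // MeasurableSet A},
    innerSL ℝ (ind g A) ⁻¹' Metric.closedBall (∫ x in A.1, f x ∂m) (b + η)
  have hmem : ∀ u : Lp ℝ 2 m, u ∈ C ↔ ∀ (g : G) (A : Set X), MeasurableSet A →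
      |∫ x in (g • ·) ⁻¹' A, u x ∂m - ∫ x in A, f x ∂m| ≤ b + η := by
    intro u
    simp only [C, ind, Set.mem_iInter, Set.mem_preimage, innerSL_apply_apply, Metric.mem_closedBall,
      Real.dist_eq, L2.inner_indicatorConstLp_one, Subtype.forall]
  have hclosed : IsClosed C := isClosed_iInter fun g => isClosed_iInter fun A =>
    Metric.isClosed_closedBall.preimage (innerSL ℝ (ind g A)).continuous
  have hconv : Convex ℝ C := convex_iInter fun g => convex_iInter fun A =>
    (convex_closedBall _ _).is_linear_preimage (innerSL ℝ (ind g A)).isLinear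
  have hne : C.Nonempty := by
    -- `f` is only in `L¹`; a simple function within `η` of it provides a point of `C` in `L²`.
    obtain ⟨h, hlt, -⟩ := (memLp_one_iff_integrable.2 hf).exists_simpleFunc_eLpNorm_sub_lt
      ENNReal.one_ne_top (ENNReal.ofReal_pos.2 hη).ne'
    have hL : MemLp h 2 m := h.memLp_of_isFiniteMeasure 2 m
    have hi : Integrable h m := h.integrable_of_isFiniteMeasure
    refine ⟨hL.toLp, (hmem _).2 fun g A hA => ?_⟩
    have h1 : ∫ x in (g • ·) ⁻¹' A, hL.toLp h x ∂m = ∫ x in (g • ·) ⁻¹' A, h x ∂m :=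
      integral_congr_ae (ae_restrict_of_ae hL.coeFn_toLp)
    have h2 : ∫ x, |f x - h x| ∂m ≤ η := by
      rw [eLpNorm_one_eq_lintegral_enorm] at hlt
      have h3 := integral_norm_eq_lintegral_enorm (hf.sub hi).aestronglyMeasurable
      simp only [Pi.sub_apply, Real.norm_eq_abs] at h3 hlt
      rw [h3]
      exact ENNReal.toReal_le_of_le_ofReal hη.le hlt.le
    have h3 : |∫ x in (g • ·) ⁻¹' A, h x ∂m - ∫ x in (g • ·) ⁻¹' A, f x ∂m| ≤ η := by
      rw [abs_sub_comm, ← integral_sub hf.integrableOn hi.integrableOn]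
      exact abs_integral_le_integral_abs.trans ((setIntegral_le_integral (hf.sub hi).abs
        (ae_of_all _ fun _ => abs_nonneg _)).trans h2)
    rw [h1]
    have := abs_sub_le (∫ x in (g • ·) ⁻¹' A, h x ∂m) (∫ x in (g • ·) ⁻¹' A, f x ∂m)
      (∫ x in A, f x ∂m)
    linarith [hb g A hA]
  obtain ⟨u, huC, hu⟩ := exists_norm_eq_iInf_of_complete_convex hne hclosed.isComplete hconv 0
  rw [norm_eq_iInf_iff_real_inner_le_zero hconv huC] at hu
  have hinv : ∀ g : G, Lp.compMeasurePreserving (g • ·) (hmp g) u = u := by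
    intro g
    set w := Lp.compMeasurePreserving (g • ·) (hmp g) u with hw
    have hwC : w ∈ C := by
      rw [hmem] at huC ⊢
      intro k A hA
      have h1 : ∫ x in (k • ·) ⁻¹' A, w x ∂m = ∫ x in ((k * g⁻¹) • ·) ⁻¹' A, u x ∂m := by
        rw [← (hmp g).setIntegral_preimage_emb (hemb g) u, ← Set.preimage_comp]
        have : ((k * g⁻¹) • · : X → X) ∘ (g • ·) = (k • ·) := by
          ext x
          simp [mul_smul]
        rw [this]
        exact integral_congr_ae (ae_restrict_of_ae (Lp.coeFn_compMeasurePreserving u (hmp g)))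
      rw [h1]
      exact huC (k * g⁻¹) A hA
    -- The variational inequality gives `‖u‖² ≤ ⟪u, w⟫`, which with `‖w‖ = ‖u‖` forces `w = u`.
    have h1 := hu w hwC
    have h2 : ‖w‖ = ‖u‖ := Lp.norm_compMeasurePreserving u (hmp g)
    rw [zero_sub, inner_neg_left, inner_sub_right, real_inner_self_eq_norm_sq] at h1
    have h3 : ‖w - u‖ ^ 2 ≤ 0 := by
      rw [norm_sub_sq_real, h2, real_inner_comm]
      linarith
    exact sub_eq_zero.1 (norm_eq_zero.1 (pow_eq_zero_iff two_ne_zero |>.1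
      (le_antisymm h3 (sq_nonneg _))))
  refine ⟨u, (Lp.memLp u).integrable one_le_two, fun g A hA => ?_, fun A hA => ?_⟩
  · rw [← (hmp g).setIntegral_preimage_emb (hemb g) u A]
    refine integral_congr_ae (ae_restrict_of_ae ?_)
    have := Lp.coeFn_compMeasurePreserving u (hmp g)
    rwa [hinv g] at this
  · simpa using (hmem u).1 huC 1 A hA

/-! ### Assembly of the invariant signed measure. -/

theorem theorem3p6 {X G : Type*} [TopologicalSpace X] [CompactSpace X] [T2Space X]
    [MeasurableSpace X] [BorelSpace X] [Group G] [MulAction G X] [ContinuousConstSMul G X]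
    (μ : SignedMeasure X) (hμ : IsRegularSigned μ) (δ : ℝ) (hδ0 : 0 < δ) (hδ1 : δ < 1)
    (h : ∀ g : G, tvNorm (gTranslate g μ - μ) ≤ δ / 10) :
    ∃ ν : SignedMeasure X, IsRegularSigned ν ∧ (∀ g : G, gTranslate g ν = ν) ∧
      tvNorm (μ - ν) ≤ 2 * δ := by
  have hmeas : ∀ g : G, Measurable (g • · : X → X) := fun g => measurable_const_smul g
  have hclose : ∀ (g : G) (A : Set X), MeasurableSet A →
      |μ ((g • ·) ⁻¹' A) - μ A| ≤ δ / 10 := by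
    intro g A hA
    have := (abs_apply_le_tvNorm (gTranslate g μ - μ) A).trans (h g)
    rwa [_root_.sub_apply, gTranslate, VectorMeasure.map_apply _ (hmeas g) hA] at this
  obtain ⟨m, s, Z, hfin, hinv, hac, hZ, hmZ, hTZ, hTle⟩ :=
    exists_invariant_measure (G := G) μ.totalVariation (c := 2 * (δ / 10))
      fun g A hA => totalVariation_real_le_preimage_add hclose g hA
  have hpre : ∀ (g : G) {N : Set X}, MeasurableSet N → m N = 0 → m ((g • ·) ⁻¹' N) = 0 := by
    intro g N hN h0
    rwa [← Measure.map_apply (hmeas g) hN, hinv g]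
  have hnull : ∀ A, MeasurableSet A → m A = 0 → μ.restrict Zᶜ A = 0 := by
    intro A hA h0
    rw [VectorMeasure.restrict_apply _ hZ.compl hA]
    refine μ.null_of_totalVariation_zero ?_
    rw [← Measure.restrict_apply hA]
    exact hTZ h0
  have hsdiff : ∀ A N, MeasurableSet A → MeasurableSet N → m N = 0 → Z ⊆ N →
      μ.restrict Zᶜ A = μ (A \ N) := by
    intro A N hA hN h0 hZN
    rw [← VectorMeasure.of_add_of_sdiff (hA.inter hN) hA Set.inter_subset_left,
      hnull _ (hA.inter hN) (measure_mono_null Set.inter_subset_right h0), zero_add,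
      VectorMeasure.restrict_apply _ hZ.compl (hA.diff (hA.inter hN)), Set.sdiff_self_inter,
      Set.inter_eq_left.2]
    exact fun x hx hxZ => hx.2 (hZN hxZ)
  set f := SignedMeasure.rnDeriv (μ.restrict Zᶜ) m with hf_def
  have hf : Integrable f m := SignedMeasure.integrable_rnDeriv _ _
  have hfA : ∀ A, MeasurableSet A → ∫ x in A, f x ∂m = μ.restrict Zᶜ A := by
    intro A hA
    rw [← withDensityᵥ_apply hf hA, hf_def, SignedMeasure.withDensityᵥ_rnDeriv_eq]
    refine VectorMeasure.AbsolutelyContinuous.mk fun A hA h0 => hnull A hA ?_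
    rwa [Measure.toENNRealVectorMeasure_apply_measurable hA] at h0
  obtain ⟨u, hu, huinv, huf⟩ := exists_invariant_integrable (G := G) m hinv hf (b := δ / 10)
    (η := δ / 10) (by positivity) (by
      intro g A hA
      -- `Z` need not be invariant. With `N = Z ∪ gZ`, which is `m`-null, both `A \ N` and its
      -- preimage under `g` avoid `Z`, so the almost invariance of `μ` itself applies.
      set N := Z ∪ (g⁻¹ • ·) ⁻¹' Z with hN_def
      have hN : MeasurableSet N := hZ.union (hmeas g⁻¹ hZ)
      have hN0 : m N = 0 := measure_union_null hmZ (hpre g⁻¹ hZ hmZ)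
      rw [hfA A hA, hfA _ (hmeas g hA), hsdiff A N hA hN hN0 Set.subset_union_left,
        hsdiff _ _ (hmeas g hA) (hmeas g hN) (hpre g hN hN0) (fun x hx => Or.inr (by simpa)),
        ← Set.preimage_sdiff]
      exact hclose g _ (hA.diff hN))
  refine ⟨m.withDensityᵥ u, ?_, fun g => ?_, ?_⟩
  · have : ∀ n, (μ.totalVariation.map (s n • ·)).Regular := fun n =>
      have : μ.totalVariation.Regular := hμ
      Measure.Regular.map (Homeomorph.smul (s n))
    refine regular_of_absolutelyContinuous_sum _ (fun n => μ.totalVariation.map (s n • ·))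
      (Measure.AbsolutelyContinuous.trans ?_ hac)
    have hu' := (SignedMeasure.absolutelyContinuous_ennreal_iff _ _).1
      (Measure.withDensityᵥ_absolutelyContinuous m u)
    rwa [show m.toENNRealVectorMeasure.ennrealToMeasure = m from
      VectorMeasure.equivMeasure.right_inv m] at hu'
  · ext A hA
    rw [gTranslate, VectorMeasure.map_apply _ (hmeas g) hA, withDensityᵥ_apply hu (hmeas g hA),
      withDensityᵥ_apply hu hA, huinv g A hA]
  -- The part in `Z` costs `4δ/10` and the density `δ/10 + δ/10`, together at most `δ`; passing to
  -- the total variation doubles this.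
  · refine (tvNorm_le_of_forall_abs_apply_le (b := δ) fun A hA => ?_)
    have h1 := huf A hA
    rw [hfA A hA, VectorMeasure.restrict_apply _ hZ.compl hA, ← withDensityᵥ_apply hu hA] at h1
    have h2 : μ A = μ (A ∩ Z) + μ (A ∩ Zᶜ) := by
      rw [← Set.sdiff_eq, ← VectorMeasure.of_add_of_sdiff (hA.inter hZ) hA Set.inter_subset_left,
        Set.sdiff_self_inter]
    have h3 : |μ (A ∩ Z)| ≤ 2 * (2 * (δ / 10)) :=
      ((μ.norm_le_totalVariation _).trans (measureReal_mono Set.inter_subset_right)).trans hTle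
    rw [_root_.sub_apply, h2, abs_le]
    rw [abs_le] at h1 h3
    constructor <;> linarith
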